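/- **Identifiability under modular distribution shifts.** Let $M\ge 1$ segments $u_1,\dots,u_M$ be given and let $n=n_{\mathrm f}+n_{\mathrm c}+n_{\mathrm o}$. In each segment $u_r$ the latent process $\mathbf z_t=(\mathbf z_t^{\mathrm{fix}},\mathbf z_t^{\mathrm{chg}},\mathbf z_t^{\mathrm{obs}})\in\mathbb R^{n_{\mathrm f}}\times\mathbb R^{n_{\mathrm c}}\times\mathbb R^{n_{\mathrm o}}=\mathbb R^n$ and the observed process $\mathbf x_t$ are generated, with maximal time lag one, by $$z^{\mathrm{fix}}_{s,t}=f_s(\mathbf{Pa}(z^{\mathrm{fix}}_{s,t}),\epsilon_{s,t}),\quad z^{\mathrm{chg}}_{c,t}=f_c(\mathbf{Pa}(z^{\mathrm{chg}}_{c,t}),\boldsymbol\theta^{\mathrm{dyn}}_r,\epsilon_{c,t}),\quad z^{\mathrm{obs}}_{o,t}=f_o(\boldsymbol\theta^{\mathrm{obs}}_r,\epsilon_{o,t}),\quad \mathbf x_t=\mathbf g(\mathbf z_t),$$ where the parents $\mathbf{Pa}(\cdot)$ are components of $\mathbf z_{t-1}$, the change factors $\boldsymbol\theta^{\mathrm{dyn}}_r,\boldsymbol\theta^{\mathrm{obs}}_r$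 are constant vectors, the noise terms are mutually independent over components and time and independent of the initial latent vector, the law of $\epsilon_{k,t}$ depends only on the component $k$, and $\mathbf g:\mathbb R^n\to\mathcal X$ is invertible. Fix a time $t\ge1$ and assume that in each segment every set of positive Lebesgue measure has positive probability under the law of $\mathbf z_{t-1}$. Suppose that the components of $\mathbf z_t$ have conditional densities given $\mathbf z_{t-1}$, positive on all of $\mathbb R$: $p(z_{k,t}\mid\mathbf z_{t-1})$, the same in all segments, for the components of $\mathbf z^{\mathrm{fix}}$; $p(z_{k,t}\mid\mathbf z_{t-1},u_r)$ for those of $\mathbf z^{\mathrm{chg}}$; and $p(z_{k,t}\mid u_r)$ for those of $\mathbf z^{\mathrm{obs}}$. Let $\eta_{k}(u_r)$ be the logarithm of the density of the $k$-th component in segment $u_r$. Assume that $\eta_k(u_r)$ is twice differentiable in $z_{k,t}$ and that $\partial\eta_k(u_r)/\partial z_{k,t}$ and $\partial^2\eta_k(u_r)/\partial z_{k,t}^2$ are differentiable in each $z_{l,t-1}$. Put $$\mathbf v_{k}(u_r)=\Big(\tfrac{\partial^2\eta_{k}(u_r)}{\partial z_{k,t}\,\partial z_{l,t-1}}\Big)_{l=1}^n,\qquad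 \mathring{\mathbf v}_{k}(u_r)=\Big(\tfrac{\partial^3\eta_{k}(u_r)}{\partial z_{k,t}^2\,\partial z_{l,t-1}}\Big)_{l=1}^n,$$ $$\mathbf s_k=\Big(\mathbf v_k(u_1),\dots,\mathbf v_k(u_M),\ \Big(\tfrac{\partial\eta_k(u_{r})}{\partial z_{k,t}}-\tfrac{\partial\eta_k(u_{r-1})}{\partial z_{k,t}}\Big)_{r=2}^{M}\Big),\qquad \mathring{\mathbf s}_k=\Big(\mathring{\mathbf v}_k(u_1),\dots,\mathring{\mathbf v}_k(u_M),\ \Big(\tfrac{\partial^2\eta_k(u_{r})}{\partial z_{k,t}^2}-\tfrac{\partial^2\eta_k(u_{r-1})}{\partial z_{k,t}^2}\Big)_{r=2}^{M}\Big).$$ (For components of $\mathbf z^{\mathrm{fix}}$ the differences vanish and only $\mathbf v_k,\mathring{\mathbf v}_k$ matter; for components of $\mathbf z^{\mathrm{obs}}$ we have $\mathbf v_k=\mathring{\mathbf v}_k=0$ and only the differences matter.) Assume that for each value of $\mathbf z_t$ the $2n$ vector functions $\mathbf s_1,\mathring{\mathbf s}_1,\dots,\mathbf s_n,\mathring{\mathbf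 s}_n$ of $\mathbf z_{t-1}$, with $k$ running over the components of all three blocks, are linearly independent. Let $\hat{\mathbf g}:\mathcal X\to\mathbb R^n$ be injective, such that $\hat{\mathbf g}\circ\mathbf g$ is twice continuously differentiable with everywhere nonsingular Jacobian, and put $\hat{\mathbf z}_t=\hat{\mathbf g}(\mathbf x_t)$. If in each segment the components of $\hat{\mathbf z}_t$ are mutually independent conditional on $\hat{\mathbf z}_{t-1}$, then $\mathbf z_t$ is an invertible, component-wise transformation of a permuted version of $\hat{\mathbf z}_t$: there are a permutation $\pi$ of $\{1,\dots,n\}$ and, for each $k$, a bijection $\tau_k$ from the set of values of the $\pi(k)$-th component of $\hat{\mathbf g}$ onto $\mathbb R$ such that, for every $\mathbf z\in\mathbb R^n$ and $k$, with $\hat{\mathbf z}=\hat{\mathbf g}(\mathbf g(\mathbf z))$, $z_k=\tau_k(\hat z_{\pi(k)})$. -/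

import Mathlib

open MeasureTheory ProbabilityTheory

namespace ModularShift

/-- Indices of the latent components: `nf` components with fixed dynamics, `nc` components with
changing dynamics, `no` components with global (observation) changes. -/
abbrev Idx (nf nc no : ℕ) : Type := Fin nf ⊕ Fin nc ⊕ Fin no

/-- The space of the latent vector `z_t = (z_t^fix, z_t^chg, z_t^obs)`. -/
abbrev Latent (nf nc no : ℕ) : Type := Idx nf nc no → ℝ

/-- The parameters of the modular generative model with maximal time lag one and `m + 1` segments
`u_0, …, u_m`: parent sets, transition functions, change factors of each segment, distributions of
the noise terms, and the invertible mixing function. -/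
structure Model (m nf nc no d₁ d₂ : ℕ) (X : Type*) where
  paFix : Fin nf → Set (Idx nf nc no)
  paChg : Fin nc → Set (Idx nf nc no)
  fFix : (s : Fin nf) → (paFix s → ℝ) → ℝ → ℝ
  fChg : (c : Fin nc) → (paChg c → ℝ) → (Fin d₁ → ℝ) → ℝ → ℝ
  fObs : Fin no → (Fin d₂ → ℝ) → ℝ → ℝ
  thetaDyn : Fin (m + 1) → Fin d₁ → ℝ
  thetaObs : Fin (m + 1) → Fin d₂ → ℝ
  noiseLaw : Idx nf nc no → Measure ℝ
  g : Latent nf nc no → X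
  measurable_fFix : ∀ s, Measurable (Function.uncurry (fFix s))
  measurable_fChg : ∀ c θ, Measurable (Function.uncurry fun a e => fChg c a θ e)
  measurable_fObs : ∀ o θ, Measurable (fObs o θ)
  bijective_g : Function.Bijective g

variable {m nf nc no d₁ d₂ : ℕ} {X : Type*}

/-- The value of the `k`-th latent component in segment `r`, given the previous latent vector `a`
and the value `e` of its noise term. -/
def Model.step (M : Model m nf nc no d₁ d₂ X) (r : Fin (m + 1)) (a : Latent nf nc no) :
    Idx nf nc no → ℝ → ℝ
  | Sum.inl s, e => M.fFix s (fun i => a i) e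
  | Sum.inr (Sum.inl c), e => M.fChg c (fun i => a i) (M.thetaDyn r) e
  | Sum.inr (Sum.inr o), e => M.fObs o (M.thetaObs r) e

/-- In every segment `r`, the noise `ε r`, the latent process `z r` and the observed process `x r`
follow the model: the noise terms are mutually independent over components and time and
independent of the initial latent vector, every latent component is produced by its transition
function, and `x_t = g(z_t)`. -/
structure Generates {Ω : Type*} [MeasurableSpace Ω] (M : Model m nf nc no d₁ d₂ X)
    (P : Measure Ω) (ε : Fin (m + 1) → ℕ → Idx nf nc no → Ω → ℝ)
    (z : Fin (m + 1) → ℕ → Ω → Latent nf nc no) (x : Fin (m + 1) → ℕ → Ω → X) : Prop where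
  measurable_noise : ∀ r t k, Measurable (ε r t k)
  noise_law : ∀ r t k, P.map (ε r t k) = M.noiseLaw k
  noise_indep : ∀ r, iIndepFun (fun (q : ℕ × Idx nf nc no) => ε r q.1 q.2) P
  measurable_init : ∀ r, Measurable (z r 0)
  init_indep : ∀ r, IndepFun (z r 0) (fun ω (q : ℕ × Idx nf nc no) => ε r q.1 q.2 ω) P
  latent_step : ∀ r t ω k, z r (t + 1) ω k = M.step r (z r t ω) k (ε r (t + 1) k ω)
  observed : ∀ r t ω, x r t ω = M.g (z r t ω)

/-- Candidate (conditional) densities for the three blocks: `p(z_s | z_{t-1})`, which does not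
depend on the segment, `p(z_c | z_{t-1}, u)`, and `p(z_o | u)`, which does not depend on the
past. The last argument is the value of the component. -/
structure Densities (m nf nc no : ℕ) where
  fix : Fin nf → Latent nf nc no → ℝ → ℝ
  chg : Fin nc → Fin (m + 1) → Latent nf nc no → ℝ → ℝ
  obs : Fin no → Fin (m + 1) → ℝ → ℝ

/-- The densities are the (conditional) densities of the components of `z_{t+1}`, given `z_t`, in
every segment. -/
structure Densities.AreDensitiesOf {Ω : Type*} [MeasurableSpace Ω] (p : Densities m nf nc no)
    (P : Measure Ω) [IsFiniteMeasure P] (z : Fin (m + 1) → ℕ → Ω → Latent nf nc no) (t : ℕ) :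
    Prop where
  fix : ∀ s r, ∀ᵐ a ∂(P.map (z r t)),
    condDistrib (fun ω => z r (t + 1) ω (Sum.inl s)) (z r t) P a =
      volume.withDensity (fun y => ENNReal.ofReal (p.fix s a y))
  chg : ∀ c r, ∀ᵐ a ∂(P.map (z r t)),
    condDistrib (fun ω => z r (t + 1) ω (Sum.inr (Sum.inl c))) (z r t) P a =
      volume.withDensity (fun y => ENNReal.ofReal (p.chg c r a y))
  obs : ∀ o r, P.map (fun ω => z r (t + 1) ω (Sum.inr (Sum.inr o))) =
      volume.withDensity (fun y => ENNReal.ofReal (p.obs o r y))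

/-- The density of the `k`-th component in segment `r`, given the previous latent vector `a`, at
the value `y`. -/
def Densities.dens (p : Densities m nf nc no) :
    Idx nf nc no → Fin (m + 1) → Latent nf nc no → ℝ → ℝ
  | Sum.inl s, _, a, y => p.fix s a y
  | Sum.inr (Sum.inl c), r, a, y => p.chg c r a y
  | Sum.inr (Sum.inr o), r, _, y => p.obs o r y

/-- `η_k(u_r)`, the logarithm of the density of the `k`-th component in segment `r`. -/
noncomputable def Densities.eta (p : Densities m nf nc no) (k : Idx nf nc no) (r : Fin (m + 1))
    (a : Latent nf nc no) (y : ℝ) : ℝ := Real.log (p.dens k r a y)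

/-- `∂η_k(u_r)/∂z_{k,t}`. -/
noncomputable def Densities.eta1 (p : Densities m nf nc no) (k : Idx nf nc no) (r : Fin (m + 1))
    (a : Latent nf nc no) (y : ℝ) : ℝ := deriv (p.eta k r a) y

/-- `∂²η_k(u_r)/∂z_{k,t}²`. -/
noncomputable def Densities.eta2 (p : Densities m nf nc no) (k : Idx nf nc no) (r : Fin (m + 1))
    (a : Latent nf nc no) (y : ℝ) : ℝ := deriv (p.eta1 k r a) y

/-- The densities are positive, and all the derivatives of `η_k` that occur below exist: `η_k` is
twice differentiable in `z_{k,t}`, and its first and second derivatives in `z_{k,t}` are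
differentiable in each coordinate of `z_{t-1}`. -/
structure Densities.Regular (p : Densities m nf nc no) : Prop where
  pos : ∀ k r a y, 0 < p.dens k r a y
  diff_eta : ∀ k r a, Differentiable ℝ (p.eta k r a)
  diff_eta1 : ∀ k r a, Differentiable ℝ (p.eta1 k r a)
  diff_eta1_past : ∀ k r a y l,
    Differentiable ℝ (fun c : ℝ => p.eta1 k r (Function.update a l c) y)
  diff_eta2_past : ∀ k r a y l,
    Differentiable ℝ (fun c : ℝ => p.eta2 k r (Function.update a l c) y)

/-- The `l`-th entry `∂²η_k(u_r)/∂z_{k,t}∂z_{l,t-1}` of `v_k(u_r)`. -/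
noncomputable def Densities.v (p : Densities m nf nc no) (k : Idx nf nc no) (r : Fin (m + 1))
    (l : Idx nf nc no) (a : Latent nf nc no) (y : ℝ) : ℝ :=
  deriv (fun c : ℝ => p.eta1 k r (Function.update a l c) y) (a l)

/-- The `l`-th entry `∂³η_k(u_r)/∂z_{k,t}²∂z_{l,t-1}` of `v̊_k(u_r)`. -/
noncomputable def Densities.vRing (p : Densities m nf nc no) (k : Idx nf nc no)
    (r : Fin (m + 1)) (l : Idx nf nc no) (a : Latent nf nc no) (y : ℝ) : ℝ :=
  deriv (fun c : ℝ => p.eta2 k r (Function.update a l c) y) (a l)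

/-- The function vector `s_k` of `z_{t-1}`, at a fixed value `y` of `z_{k,t}`: the vectors `v_k` in
all the segments, and the differences of `∂η_k/∂z_{k,t}` between consecutive segments. -/
noncomputable def Densities.s (p : Densities m nf nc no) (k : Idx nf nc no) (y : ℝ) :
    Latent nf nc no → (Fin (m + 1) → Idx nf nc no → ℝ) × (Fin m → ℝ) := fun a =>
  (fun r l => p.v k r l a y, fun i => p.eta1 k i.succ a y - p.eta1 k i.castSucc a y)

/-- The function vector `s̊_k` of `z_{t-1}`, at a fixed value `y` of `z_{k,t}`: the vectors `v̊_k` in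
all the segments, and the differences of `∂²η_k/∂z_{k,t}²` between consecutive segments. -/
noncomputable def Densities.sRing (p : Densities m nf nc no) (k : Idx nf nc no) (y : ℝ) :
    Latent nf nc no → (Fin (m + 1) → Idx nf nc no → ℝ) × (Fin m → ℝ) := fun a =>
  (fun r l => p.vRing k r l a y, fun i => p.eta2 k i.succ a y - p.eta2 k i.castSucc a y)

/-- For every value `w` of `z_t`, the `2n` function vectors `s_k`, `s̊_k` of `z_{t-1}`, with `k`
running over all the latent components, are linearly independent. -/
def Densities.FunctionVectorsIndependent (p : Densities m nf nc no) : Prop :=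
  ∀ w : Latent nf nc no, LinearIndependent ℝ
    (Sum.elim (fun k : Idx nf nc no => p.s k (w k)) (fun k : Idx nf nc no => p.sRing k (w k)))

/-- The components of `Y` are mutually independent conditional on `W`. -/
def ComponentsCondIndep {Ω : Type*} [MeasurableSpace Ω] [StandardBorelSpace Ω] (P : Measure Ω)
    [IsFiniteMeasure P] (Y W : Ω → Latent nf nc no) (hW : Measurable W) : Prop :=
  iCondIndepFun (MeasurableSpace.comap W inferInstance) hW.comap_le (fun k ω => Y ω k) P

/-- `z` is an invertible, component-wise transformation of a permuted version of `zhat z`: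
`z_k = τ_k(ẑ_{π(k)})`, where `τ_k` is a bijection from the set of values of `ẑ_{π(k)}` onto the set
of values of `z_k`. -/
def IdentifiedUpToPermutation (zhat : Latent nf nc no → Latent nf nc no) : Prop :=
  ∃ (π : Equiv.Perm (Idx nf nc no)) (τ : Idx nf nc no → ℝ → ℝ),
    (∀ k, Set.BijOn (τ k) (Set.range fun z => zhat z (π k)) Set.univ) ∧
    ∀ z k, z k = τ k (zhat z (π k))

end ModularShift

namespace ModularShift

variable {m nf nc no d₁ d₂ : ℕ} {X : Type*}

/-! Write `H = ĝ ∘ g`, with inverse `ζ` on its open range. Given the past `a`, the next latent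
vector has a product law. Conditional independence of the estimated components says that, for almost
every `a`, `H` pushes this law to another product law (`ae_hasProductImage`).

Compare two such laws, for `(r, a)` and `(r', a')`. Their relative density is the same whether
computed before or after `H`, so no Jacobian determinant enters, and it factorizes on both sides.
Hence the sum over `k` of the differences of `η_k`, evaluated at `ζ_k(y)`, is almost everywhere
additively separable in `y` (`log_density_separable`). Its mixed derivatives in `y_j`, `y_j'` vanish
(`sum_mixed_deriv_eq_zero`), so `∑ (η_k'' A_k + η_k' B_k)`, with `A_k = ∂_j ζ_k ∂_j' ζ_k` and `B_k =
∂_j ∂_j' ζ_k`, has one value for all segments and almost all pasts.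

Differentiating this in the past, and subtracting consecutive segments, gives a linear relation
between the `s_k` and `s̊_k`, with coefficients `B_k` and `A_k`. Independence forces `A_k = 0`
(`Densities.coeff_eq_zero`). Each row of the Jacobian of `ζ` thus has at most one nonzero entry, so
the Jacobian of `H` is a generalized permutation matrix. By continuity its pattern is constant, and
`H` acts component-wise. -/

/-! ### Relative densities of product measures -/

theorem pi_withDensity {ι : Type*} [Fintype ι] (μ ν : ι → Measure ℝ)
    [∀ i, IsProbabilityMeasure (μ i)] [∀ i, SigmaFinite (ν i)] (f : ι → ℝ → ENNReal)
    (hf : ∀ i, Measurable (f i)) (hν : ∀ i, ν i = (μ i).withDensity (f i)) :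
    Measure.pi ν = (Measure.pi μ).withDensity (fun x => ∏ i, f i (x i)) := by
  refine Measure.pi_eq fun s hs => ?_
  rw [withDensity_apply _ (MeasurableSet.univ_pi hs), ← lintegral_indicator (MeasurableSet.univ_pi hs)]
  have h1 : (fun x : ι → ℝ => (Set.univ.pi s).indicator (fun x => ∏ i, f i (x i)) x) =
      fun x => ∏ i, (s i).indicator (f i) (x i) := by
    funext x
    by_cases hx : x ∈ Set.univ.pi s
    · rw [Set.indicator_of_mem hx]
      exact Finset.prod_congr rfl fun i _ => (Set.indicator_of_mem (hx i trivial) _).symm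
    · rw [Set.indicator_of_notMem hx]
      obtain ⟨i, hi⟩ : ∃ i, x i ∉ s i := by simpa [Set.mem_pi] using hx
      exact (Finset.prod_eq_zero (Finset.mem_univ i) (Set.indicator_of_notMem hi _)).symm
  have hm : ∀ i, Measurable ((s i).indicator (f i)) := fun i => (hf i).indicator (hs i)
  have h2 := lintegral_prod_eq_prod_lintegral_of_indepFun Finset.univ
    (fun i (x : ι → ℝ) => (s i).indicator (f i) (x i))
    (iIndepFun_pi (μ := μ) fun i => (hm i).aemeasurable) (fun i => (hm i).comp (measurable_pi_apply i))
  rw [h1, h2]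
  refine Finset.prod_congr rfl fun i _ => ?_
  rw [hν i, withDensity_apply _ (hs i), ← lintegral_indicator (hs i)]
  exact (measurePreserving_eval μ i).lintegral_comp (hm i)

/-- If the images under `H` of two product measures with positive relative densities are both
product measures, then the logarithm of the relative density is additively separable in the
coordinates of `H`. -/
theorem log_density_separable {ι : Type*} [Fintype ι] (μ ν : ι → Measure ℝ)
    [∀ i, IsProbabilityMeasure (μ i)] [∀ i, IsProbabilityMeasure (ν i)]
    (p q : ι → ℝ → ℝ) (hp : ∀ i, Measurable (p i)) (hq : ∀ i, Measurable (q i))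
    (hp0 : ∀ i y, 0 < p i y) (hq0 : ∀ i y, 0 < q i y)
    (hμ : ∀ i, μ i = volume.withDensity (fun y => ENNReal.ofReal (p i y)))
    (hν : ∀ i, ν i = volume.withDensity (fun y => ENNReal.ofReal (q i y)))
    (H : (ι → ℝ) → ι → ℝ) (hH : MeasurableEmbedding H)
    (hμH : (Measure.pi μ).map H = Measure.pi fun j => (Measure.pi μ).map fun z => H z j)
    (hνH : (Measure.pi ν).map H = Measure.pi fun j => (Measure.pi ν).map fun z => H z j) :
    ∃ F : ι → ℝ → ℝ, ∀ᵐ z : ι → ℝ,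
      ∑ i, (Real.log (p i (z i)) - Real.log (q i (z i))) = ∑ j, F j (H z j) := by
  have hHj : ∀ j, Measurable fun z => H z j := fun j => (measurable_pi_apply j).comp hH.measurable
  have hvol : ∀ i, volume = (ν i).withDensity (fun y => (ENNReal.ofReal (q i y))⁻¹) := by
    intro i
    rw [hν i, withDensity_inv_same (by have := hq i; fun_prop)]
    · exact ae_of_all _ fun y => by simpa using hq0 i y
    · exact ae_of_all _ fun y => ENNReal.ofReal_ne_top
  have hμν : ∀ i, μ i = (ν i).withDensity (fun y => ENNReal.ofReal (p i y / q i y)) := by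
    intro i
    rw [hμ i, hν i, ← withDensity_mul _ (by have := hq i; fun_prop)
      (by have := hq i; have := hp i; fun_prop)]
    congr 1
    funext y
    rw [Pi.mul_apply, ← ENNReal.ofReal_mul (hq0 i y).le, mul_div_cancel₀ _ (hq0 i y).ne']
  have hvolpi : (volume : Measure (ι → ℝ)) ≪ Measure.pi ν := by
    rw [volume_pi, pi_withDensity ν (fun _ => volume) _ (by intro i; have := hq i; fun_prop) hvol]
    exact withDensity_absolutelyContinuous _ _
  have hpi := pi_withDensity ν μ _ (by intro i; have := hq i; have := hp i; fun_prop) hμν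
  set R : (ι → ℝ) → ENNReal := fun z => ∏ i, ENNReal.ofReal (p i (z i) / q i (z i)) with hR
  set Q : ι → Measure ℝ := fun j => (Measure.pi μ).map fun z => H z j with hQ
  set Q' : ι → Measure ℝ := fun j => (Measure.pi ν).map fun z => H z j with hQ'
  have : ∀ j, IsProbabilityMeasure (Q j) := fun j =>
    Measure.isProbabilityMeasure_map (hHj j).aemeasurable
  have : ∀ j, IsProbabilityMeasure (Q' j) := fun j =>
    Measure.isProbabilityMeasure_map (hHj j).aemeasurable
  have hQQ : ∀ j, Q j ≪ Q' j := fun j => by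
    refine Measure.AbsolutelyContinuous.map ?_ (hHj j)
    rw [hpi]; exact withDensity_absolutelyContinuous _ _
  set ρ : ι → ℝ → ENNReal := fun j => (Q j).rnDeriv (Q' j) with hρ
  have hρm : ∀ j, Measurable (ρ j) := fun j => Measure.measurable_rnDeriv _ _
  have hQpi := pi_withDensity Q' Q ρ hρm fun j => (Measure.withDensity_rnDeriv_eq _ _ (hQQ j)).symm
  set φ : (ι → ℝ) → ENNReal := fun y => ∏ j, ρ j (y j) with hφ
  have hφm : Measurable φ := Finset.measurable_prod _ fun j _ =>
    (hρm j).comp (measurable_pi_apply j)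
  have hRm : Measurable R := Finset.measurable_prod _ fun i _ => by
    have h1 : Measurable fun z : ι → ℝ => p i (z i) := (hp i).comp (measurable_pi_apply i)
    have h2 : Measurable fun z : ι → ℝ => q i (z i) := (hq i).comp (measurable_pi_apply i)
    exact (h1.div h2).ennreal_ofReal
  -- Since `H` is a measurable embedding, each measurable `s` is the preimage of the measurable set
  -- `H '' s`; so the density `φ` between the image laws pulls back to a density between the
  -- original ones.
  have key : (Measure.pi ν).withDensity R = (Measure.pi ν).withDensity (φ ∘ H) := by
    rw [← hpi]
    ext s hs
    have e1 : Measure.pi μ s = ((Measure.pi μ).map H) (H '' s) := by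
      rw [hH.map_apply, hH.injective.preimage_image]
    have hs' : MeasurableSet (H '' s) := hH.measurableSet_image.2 hs
    rw [e1, hμH, hQpi, ← hνH, withDensity_apply _ hs', withDensity_apply _ hs, setLIntegral_map hs' hφm
      hH.measurable, hH.injective.preimage_image]
    rfl
  have hae : R =ᵐ[Measure.pi ν] φ ∘ H := by
    refine (withDensity_eq_iff hRm.aemeasurable (hφm.comp hH.measurable).aemeasurable ?_).1 key
    rw [← setLIntegral_univ, ← withDensity_apply _ MeasurableSet.univ, ← hpi]
    exact measure_ne_top _ _
  -- No regularity of `F` is available: it is built from Radon-Nikodym derivatives of the marginals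
  -- of the image laws. Positivity of `R` rules out the values `0` and `∞` of the factors almost
  -- everywhere.
  refine ⟨fun j y => Real.log (ρ j y).toReal, ?_⟩
  filter_upwards [hvolpi.ae_le hae] with z hz
  have hlog : Real.log (R z).toReal = Real.log ((φ ∘ H) z).toReal := by rw [hz]
  have hRpos : (R z).toReal ≠ 0 := by
    simp only [hR, ENNReal.toReal_prod]
    refine Finset.prod_ne_zero_iff.2 fun i _ => ?_
    rw [ENNReal.toReal_ofReal (div_pos (hp0 _ _) (hq0 _ _)).le]
    exact (div_pos (hp0 _ _) (hq0 _ _)).ne'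
  have hφpos : ((φ ∘ H) z).toReal ≠ 0 := hz ▸ hRpos
  simp only [hφ, hR, Function.comp, ENNReal.toReal_prod] at hlog hφpos hRpos
  rw [Real.log_prod (fun i _ => Finset.prod_ne_zero_iff.1 hRpos i (Finset.mem_univ i)),
    Real.log_prod (fun i _ => Finset.prod_ne_zero_iff.1 hφpos i (Finset.mem_univ i))] at hlog
  rw [← hlog]
  refine Finset.sum_congr rfl fun i _ => ?_
  rw [ENNReal.toReal_ofReal (div_pos (hp0 _ _) (hq0 _ _)).le,
    Real.log_div (hp0 _ _).ne' (hq0 _ _).ne']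

/-! ### Transition law of the latent process -/

/-- If `W` is independent of `(Y, Z)`, and `Y` of `Z`, then `(W, Y)` is independent of `Z`. -/
theorem indepFun_prodMk_of_indepFun {Ω α β γ : Type*} [MeasurableSpace Ω] [MeasurableSpace α]
    [MeasurableSpace β] [MeasurableSpace γ] {P : Measure Ω} [IsProbabilityMeasure P]
    {W : Ω → α} {Y : Ω → β} {Z : Ω → γ} (hW : Measurable W) (hY : Measurable Y) (hZ : Measurable Z)
    (h₁ : IndepFun W (fun ω => (Y ω, Z ω)) P) (h₂ : IndepFun Y Z P) :
    IndepFun (fun ω => (W ω, Y ω)) Z P := by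
  have hWY : IndepFun W Y P := h₁.comp measurable_id measurable_fst
  rw [indepFun_iff_map_prod_eq_prod_map_map (by fun_prop) (by fun_prop)] at h₁ h₂ hWY ⊢
  have := Measure.isProbabilityMeasure_map (μ := P) hW.aemeasurable
  have := Measure.isProbabilityMeasure_map (μ := P) hY.aemeasurable
  have := Measure.isProbabilityMeasure_map (μ := P) hZ.aemeasurable
  have e : P.map (fun ω => ((W ω, Y ω), Z ω)) =
      (P.map (fun ω => (W ω, (Y ω, Z ω)))).map MeasurableEquiv.prodAssoc.symm := by
    rw [Measure.map_map (by fun_prop) (by fun_prop)]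
    rfl
  rw [e, h₁, h₂, hWY]
  have := (measurePreserving_prodAssoc (P.map W) (P.map Y) (P.map Z)).symm
  exact this.map_eq

theorem Model.measurable_step (M : Model m nf nc no d₁ d₂ X) (r : Fin (m + 1)) (k : Idx nf nc no) :
    Measurable fun q : Latent nf nc no × ℝ => M.step r q.1 k q.2 := by
  rcases k with s | c | o
  · have h : Measurable fun q : Latent nf nc no × ℝ => ((fun i : M.paFix s => q.1 i), q.2) := by
      fun_prop
    exact (M.measurable_fFix s).comp h
  · have h : Measurable fun q : Latent nf nc no × ℝ => ((fun i : M.paChg c => q.1 i), q.2) := by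
      fun_prop
    exact (M.measurable_fChg c (M.thetaDyn r)).comp h
  · exact (M.measurable_fObs o (M.thetaObs r)).comp measurable_snd

theorem Model.measurable_step_comp {α : Type*} {_ : MeasurableSpace α}
    (M : Model m nf nc no d₁ d₂ X) (r : Fin (m + 1)) (k : Idx nf nc no) {f : α → Latent nf nc no}
    {e : α → ℝ} (hf : Measurable f) (he : Measurable e) :
    Measurable fun ω => M.step r (f ω) k (e ω) :=
  (M.measurable_step r k).comp (hf.prodMk he)

/-- The σ-algebra is left free so that it can be the one generated by the initial vector and the
noise up to time `n`; hence noise is required to be measurable only up to that time. -/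
theorem Model.measurable_recursion {α : Type*} {_ : MeasurableSpace α}
    (M : Model m nf nc no d₁ d₂ X) (r : Fin (m + 1)) (e : ℕ → Idx nf nc no → α → ℝ)
    (w : ℕ → α → Latent nf nc no)
    (hw : ∀ t ω k, w (t + 1) ω k = M.step r (w t ω) k (e (t + 1) k ω)) (h0 : Measurable (w 0))
    (n : ℕ) (he : ∀ t k, t + 1 ≤ n → Measurable (e (t + 1) k)) : Measurable (w n) := by
  induction n with
  | zero => exact h0
  | succ n ih =>
    refine measurable_pi_lambda _ fun k => ?_
    simp only [hw]
    exact M.measurable_step_comp r k (ih fun t k ht => he t k (by omega)) (he n k le_rfl)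

namespace Generates

variable {Ω : Type*} [MeasurableSpace Ω] {P : Measure Ω}
  {M : Model m nf nc no d₁ d₂ X}
  {ε : Fin (m + 1) → ℕ → Idx nf nc no → Ω → ℝ}
  {z : Fin (m + 1) → ℕ → Ω → Latent nf nc no} {x : Fin (m + 1) → ℕ → Ω → X}

theorem measurable_latent (h : Generates M P ε z x) (r : Fin (m + 1)) (t : ℕ) :
    Measurable (z r t) :=
  M.measurable_recursion r (ε r) (z r) (h.latent_step r) (h.measurable_init r) t
    fun s k _ => h.measurable_noise r (s + 1) k

/-- The latent vector at time `t` is independent of the noise at time `t + 1`. -/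
theorem indepFun_latent_noise [IsProbabilityMeasure P] (h : Generates M P ε z x) (r : Fin (m + 1))
    (t : ℕ) : IndepFun (z r t) (fun ω k => ε r (t + 1) k ω) P := by
  set e : ℕ × Idx nf nc no → Ω → ℝ := fun q ω => ε r q.1 q.2 ω with he
  have hem : ∀ q, Measurable (e q) := fun q => h.measurable_noise r _ _
  set S : Finset (ℕ × Idx nf nc no) := Finset.range (t + 1) ×ˢ Finset.univ with hS
  set T : Finset (ℕ × Idx nf nc no) := {t + 1} ×ˢ Finset.univ with hT
  have hST : Disjoint S T := by
    rw [Finset.disjoint_left]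
    rintro ⟨a, b⟩ h₁ h₂
    simp only [hS, hT, Finset.mem_product, Finset.mem_range, Finset.mem_singleton] at h₁ h₂
    omega
  have hYZ : IndepFun (fun ω (i : S) => e i ω) (fun ω (i : T) => e i ω) P :=
    (h.noise_indep r).indepFun_finset S T hST hem
  have hW : IndepFun (z r 0) (fun ω => ((fun i : S => e i ω), (fun i : T => e i ω))) P := by
    have hφ : Measurable fun u : ℕ × Idx nf nc no → ℝ =>
      ((fun i : S => u i), (fun i : T => u i)) := by fun_prop
    exact (h.init_indep r).comp measurable_id hφ
  have key := indepFun_prodMk_of_indepFun (h.measurable_init r)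
    (measurable_pi_lambda _ fun i => hem _) (measurable_pi_lambda _ fun i => hem _) hW hYZ
  set V : Ω → Latent nf nc no × (S → ℝ) := fun ω => (z r 0 ω, fun i => e i ω) with hV
  have hz : Measurable[MeasurableSpace.comap V inferInstance] (z r t) := by
    refine @Model.measurable_recursion _ _ _ _ _ _ _ _ (MeasurableSpace.comap V inferInstance)
      M r (ε r) (z r) (h.latent_step r) ?_ t fun s k hs => ?_
    · exact measurable_fst.comp (comap_measurable V)
    · have hk : (s + 1, k) ∈ S := by
        simp only [hS, Finset.mem_product, Finset.mem_range, Finset.mem_univ, and_true]; omega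
      exact ((measurable_pi_apply (⟨(s + 1, k), hk⟩ : S)).comp measurable_snd).comp
        (comap_measurable V)
  have h2 : IndepFun V (fun ω k => ε r (t + 1) k ω) P := by
    have hφ : Measurable fun (u : T → ℝ) (k : Idx nf nc no) =>
        u ⟨(t + 1, k), by simp [hT]⟩ := by fun_prop
    exact key.comp measurable_id hφ
  rw [IndepFun_iff_Indep] at h2 ⊢
  exact indep_of_indep_of_le_left h2 hz.comap_le

theorem isProbabilityMeasure_noiseLaw [IsProbabilityMeasure P] (h : Generates M P ε z x)
    (k : Idx nf nc no) : IsProbabilityMeasure (M.noiseLaw k) := by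
  rw [← h.noise_law 0 0 k]
  exact Measure.isProbabilityMeasure_map (h.measurable_noise 0 0 k).aemeasurable

theorem map_noise [IsProbabilityMeasure P] (h : Generates M P ε z x) (r : Fin (m + 1)) (t : ℕ) :
    P.map (fun ω k => ε r t k ω) = Measure.pi M.noiseLaw := by
  have h1 : iIndepFun (fun k => ε r t k) P :=
    (h.noise_indep r).precomp (g := fun k => (t, k)) fun a b hab => by simpa using hab
  rw [iIndepFun_iff_map_fun_eq_pi_map fun k => (h.measurable_noise r t k).aemeasurable] at h1
  rw [h1]
  congr 1
  funext k
  exact h.noise_law r t k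

end Generates

/-- The transition kernel of the latent process. -/
noncomputable def Model.transition (M : Model m nf nc no d₁ d₂ X) (r : Fin (m + 1)) :
    Kernel (Latent nf nc no) (Latent nf nc no) :=
  (Kernel.id ×ₖ Kernel.const _ (Measure.pi M.noiseLaw)).map
    fun q : Latent nf nc no × Latent nf nc no => fun k => M.step r q.1 k (q.2 k)

theorem Model.measurable_stepVec (M : Model m nf nc no d₁ d₂ X) (r : Fin (m + 1)) :
    Measurable fun q : Latent nf nc no × Latent nf nc no => fun k => M.step r q.1 k (q.2 k) := by
  exact measurable_pi_lambda _ fun k => M.measurable_step_comp r k measurable_fst (by fun_prop)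

/-- Once the past is frozen, each component is a function of its own noise term alone. -/
theorem Model.transition_apply (M : Model m nf nc no d₁ d₂ X)
    [∀ k, IsProbabilityMeasure (M.noiseLaw k)] (r : Fin (m + 1)) (a : Latent nf nc no) :
    M.transition r a = Measure.pi fun k => (M.noiseLaw k).map (M.step r a k) := by
  have hs : ∀ k, Measurable (M.step r a k) := fun k =>
    (M.measurable_step r k).comp measurable_prodMk_left
  rw [Model.transition, Kernel.map_apply _ (M.measurable_stepVec r), Kernel.prod_apply,
    Kernel.id_apply, Kernel.const_apply, Measure.dirac_prod, Measure.map_map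
    (M.measurable_stepVec r) measurable_prodMk_left]
  have := fun k => Measure.isProbabilityMeasure_map (μ := M.noiseLaw k) (hs k).aemeasurable
  rw [← Measure.pi_map_pi fun k => (hs k).aemeasurable]
  rfl

instance Model.isMarkovKernel_transition (M : Model m nf nc no d₁ d₂ X)
    [∀ k, IsProbabilityMeasure (M.noiseLaw k)] (r : Fin (m + 1)) :
    IsMarkovKernel (M.transition r) :=
  Kernel.IsMarkovKernel.map _ (M.measurable_stepVec r)

/-- The new noise is independent of the present vector, so conditioning amounts to freezing the past
in the transition function. -/
theorem Generates.condDistrib_latent {Ω : Type*} [MeasurableSpace Ω] {P : Measure Ω}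
    [IsProbabilityMeasure P] {M : Model m nf nc no d₁ d₂ X}
    [∀ k, IsProbabilityMeasure (M.noiseLaw k)]
    {ε : Fin (m + 1) → ℕ → Idx nf nc no → Ω → ℝ}
    {z : Fin (m + 1) → ℕ → Ω → Latent nf nc no} {x : Fin (m + 1) → ℕ → Ω → X}
    (h : Generates M P ε z x) (r : Fin (m + 1)) (t : ℕ) :
    condDistrib (z r (t + 1)) (z r t) P =ᵐ[P.map (z r t)] M.transition r := by
  have hz := h.measurable_latent r
  refine condDistrib_ae_eq_of_measure_eq_compProd _ (hz _).aemeasurable ?_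
  have hn : Measurable fun ω k => ε r (t + 1) k ω :=
    measurable_pi_lambda _ fun k => h.measurable_noise r (t + 1) k
  have hind := (indepFun_iff_map_prod_eq_prod_map_map (hz t).aemeasurable hn.aemeasurable).1
    (h.indepFun_latent_noise r t)
  rw [h.map_noise r (t + 1)] at hind
  have hF : Measurable fun q : Latent nf nc no × Latent nf nc no =>
      (q.1, fun k => M.step r q.1 k (q.2 k)) := measurable_fst.prodMk (M.measurable_stepVec r)
  have e : P.map (fun ω => (z r t ω, z r (t + 1) ω)) =
      (P.map (fun ω => (z r t ω, fun k => ε r (t + 1) k ω))).map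
        (fun q => (q.1, fun k => M.step r q.1 k (q.2 k))) := by
    rw [Measure.map_map hF ((hz t).prodMk hn)]
    congr 1
    funext ω
    refine Prod.ext rfl ?_
    funext k
    exact h.latent_step r t ω k
  have := Measure.isProbabilityMeasure_map (μ := P) (hz t).aemeasurable
  rw [e, hind]
  ext s hs
  rw [Measure.map_apply hF hs, Measure.prod_apply (hF hs), Measure.compProd_apply hs]
  refine lintegral_congr fun a => ?_
  rw [Model.transition, Kernel.map_apply _ (M.measurable_stepVec r), Kernel.prod_apply,
    Kernel.id_apply, Kernel.const_apply, Measure.dirac_prod, Measure.map_map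
    (M.measurable_stepVec r) measurable_prodMk_left, Measure.map_apply
    ((M.measurable_stepVec r).comp measurable_prodMk_left) (measurable_prodMk_left hs)]
  rfl

/-! ### Conditional independence as a product structure of conditional laws -/

/-- If the components of `H ∘ Z'` are conditionally independent given `H ∘ Z`, then almost every
conditional law of `H ∘ Z'` given `Z` is a product measure. -/
theorem ae_map_eq_pi_of_iCondIndepFun {ι Ω : Type*} [Fintype ι] [MeasurableSpace Ω]
    [StandardBorelSpace Ω] {P : Measure Ω} [IsProbabilityMeasure P] {Z Z' : Ω → ι → ℝ}
    (hZ : Measurable Z) (hZ' : Measurable Z') (κ : Kernel (ι → ℝ) (ι → ℝ)) [IsMarkovKernel κ]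
    (hκ : condDistrib Z' Z P =ᵐ[P.map Z] κ) {H : (ι → ℝ) → ι → ℝ} (hH : MeasurableEmbedding H)
    (hle : MeasurableSpace.comap (fun ω => H (Z ω)) inferInstance ≤ ‹MeasurableSpace Ω›)
    (hind : iCondIndepFun (MeasurableSpace.comap (fun ω => H (Z ω)) inferInstance) hle
      (fun k ω => H (Z' ω) k) P) :
    ∀ᵐ a ∂(P.map Z), (κ a).map H = Measure.pi fun j => (κ a).map fun w => H w j := by
  have hHj : ∀ j, Measurable fun w => H w j := fun j => (measurable_pi_apply j).comp hH.measurable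
  -- An embedding loses no information: conditioning on `H ∘ Z` is conditioning on `Z`.
  have hcomap : MeasurableSpace.comap (fun ω => H (Z ω)) inferInstance =
      MeasurableSpace.comap Z inferInstance := by
    conv_rhs => rw [← hH.comap_eq, MeasurableSpace.comap_comp]
    rfl
  have hY : ∀ k, Measurable fun ω => H (Z' ω) k := fun k => (hHj k).comp hZ'
  rw [iCondIndepFun_iff_condExp_inter_preimage_eq_mul _ _ hY] at hind
  have hce : ∀ s : Set (ι → ℝ), MeasurableSet s →
      (fun ω => (κ (Z ω)).real s) =ᵐ[P]
        P⟦Z' ⁻¹' s | MeasurableSpace.comap (fun ω => H (Z ω)) inferInstance⟧ := by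
    intro s hs
    rw [hcomap]
    refine Filter.EventuallyEq.trans ?_ (condDistrib_ae_eq_condExp hZ hZ' hs)
    filter_upwards [ae_of_ae_map hZ.aemeasurable hκ] with ω hω
    rw [hω]
  have hbox : ∀ B : ι → Set ℝ, (∀ j, MeasurableSet (B j)) → ∀ᵐ a ∂(P.map Z),
      (κ a).real (⋂ j ∈ Finset.univ, (fun w => H w j) ⁻¹' B j) =
        ∏ j, (κ a).real ((fun w => H w j) ⁻¹' B j) := by
    intro B hB
    have hBm : MeasurableSet (⋂ j ∈ (Finset.univ : Finset ι), (fun w => H w j) ⁻¹' B j) :=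
      Finset.measurableSet_biInter _ fun j _ => hHj j (hB j)
    have hr : ∀ s : Set (ι → ℝ), MeasurableSet s → Measurable fun a => (κ a).real s :=
      fun s hs => (κ.measurable_coe hs).ennreal_toReal
    rw [ae_map_iff hZ.aemeasurable (measurableSet_eq_fun (hr _ hBm)
      (Finset.measurable_prod _ fun j _ => hr _ (hHj j (hB j))))]
    have hall := ae_all_iff.2 fun j => hce _ (hHj j (hB j))
    filter_upwards [hind Finset.univ (sets := B) fun j _ => hB j, hce _ hBm, hall] with ω h₁ h₂ h₃
    rw [h₂]
    have e : Z' ⁻¹' (⋂ j ∈ Finset.univ, (fun w => H w j) ⁻¹' B j) =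
        ⋂ j ∈ Finset.univ, (fun ω => H (Z' ω) j) ⁻¹' B j := by
      ext; simp
    rw [e, h₁, Finset.prod_apply]
    exact Finset.prod_congr rfl fun j _ => (h₃ j).symm
  -- The exceptional null set depends on the box, so only countably many boxes are used; the
  -- rational ones determine the measure.
  have hrat := ae_all_iff.2 fun q : ι → ℚ × ℚ =>
    hbox (fun j => Set.Ioo ((q j).1 : ℝ) (q j).2) fun j => measurableSet_Ioo
  filter_upwards [hrat] with a ha
  have := fun j => Measure.isProbabilityMeasure_map (μ := κ a) (hHj j).aemeasurable
  refine (Measure.pi_eq_generateFrom (fun _ => Real.borel_eq_generateFrom_Ioo_rat.symm)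
    (fun _ => Real.isPiSystem_Ioo_rat) (fun _ => Real.finiteSpanningSetsInIooRat _) ?_).symm
  simp only [Set.mem_iUnion, Set.mem_singleton_iff]
  intro s hs
  choose b c hbc using hs
  obtain rfl : s = fun i => Set.Ioo (b i : ℝ) (c i) := funext fun i => (hbc i).2
  rw [hH.map_apply, ← ENNReal.toReal_eq_toReal_iff' (measure_ne_top _ _)
    (ENNReal.prod_ne_top fun _ _ => measure_ne_top _ _), ENNReal.toReal_prod]
  have := ha fun j => (b j, c j)
  have e : H ⁻¹' Set.univ.pi (fun i => Set.Ioo (b i : ℝ) (c i)) =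
      ⋂ j ∈ Finset.univ, (fun w => H w j) ⁻¹' Set.Ioo (b j : ℝ) (c j) := by
    ext; simp [Set.mem_pi]
  rw [e]
  refine this.trans (Finset.prod_congr rfl fun j _ => ?_)
  rw [Measure.map_apply (hHj j) measurableSet_Ioo]
  rfl

theorem Densities.AreDensitiesOf.ae_map_step {Ω : Type*} [MeasurableSpace Ω]
    {P : Measure Ω} [IsProbabilityMeasure P] {M : Model m nf nc no d₁ d₂ X}
    [∀ k, IsProbabilityMeasure (M.noiseLaw k)]
    {ε : Fin (m + 1) → ℕ → Idx nf nc no → Ω → ℝ}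
    {z : Fin (m + 1) → ℕ → Ω → Latent nf nc no} {x : Fin (m + 1) → ℕ → Ω → X}
    {p : Densities m nf nc no} {t : ℕ} (hp : p.AreDensitiesOf P z t)
    (h : Generates M P ε z x) (r : Fin (m + 1)) (k : Idx nf nc no) :
    ∀ᵐ a ∂(P.map (z r t)), (M.noiseLaw k).map (M.step r a k) =
      volume.withDensity fun y => ENNReal.ofReal (p.dens k r a y) := by
  have hz := h.measurable_latent r
  have hs : ∀ a k, Measurable (M.step r a k) := fun a k =>
    M.measurable_step_comp r k measurable_const measurable_id
  have hprob : ∀ a k, IsProbabilityMeasure ((M.noiseLaw k).map (M.step r a k)) := fun a k =>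
    Measure.isProbabilityMeasure_map (hs a k).aemeasurable
  have hcd : ∀ᵐ a ∂(P.map (z r t)), condDistrib (fun ω => z r (t + 1) ω k) (z r t) P a =
      (M.noiseLaw k).map (M.step r a k) := by
    filter_upwards [h.condDistrib_latent r t, condDistrib_comp (μ := P) (z r t)
      (hz (t + 1)).aemeasurable (measurable_pi_apply k)] with a h₁ h₂
    have h₃ : condDistrib (fun ω => z r (t + 1) ω k) (z r t) P a =
      ((condDistrib (z r (t + 1)) (z r t) P).map fun w => w k) a := h₂
    rw [h₃, Kernel.map_apply _ (measurable_pi_apply k), h₁, M.transition_apply]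
    exact (measurePreserving_eval _ k).map_eq
  rcases k with s | c | o
  · filter_upwards [hcd, hp.fix s r] with a h₁ h₂
    rw [← h₁, h₂]
    rfl
  · filter_upwards [hcd, hp.chg c r] with a h₁ h₂
    rw [← h₁, h₂]
    rfl
  -- Here the given density is unconditional; the transition ignores `a`, so the marginal law
  -- already is the conditional one.
  · refine ae_of_all _ fun a => ?_
    have h₁ := hp.obs o r
    have e : (fun ω => z r (t + 1) ω (Sum.inr (Sum.inr o))) =
      M.fObs o (M.thetaObs r) ∘ ε r (t + 1) (Sum.inr (Sum.inr o)) :=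
      funext fun ω => h.latent_step r t ω _
    rw [e, ← Measure.map_map (M.measurable_fObs _ _) (h.measurable_noise _ _ _), h.noise_law] at h₁
    exact h₁

/-- In segment `r` and given the previous latent vector `a`, the components of the latent vector have
probability densities, and the image under `H` of their product is again a product measure. -/
def Densities.HasProductImage (p : Densities m nf nc no) (H : Latent nf nc no → Latent nf nc no)
    (r : Fin (m + 1)) (a : Latent nf nc no) : Prop :=
  (∀ k, IsProbabilityMeasure (volume.withDensity fun y => ENNReal.ofReal (p.dens k r a y))) ∧
    (Measure.pi fun k => volume.withDensity fun y => ENNReal.ofReal (p.dens k r a y)).map H =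
      Measure.pi fun j =>
        (Measure.pi fun k => volume.withDensity fun y => ENNReal.ofReal (p.dens k r a y)).map
          fun w => H w j

/-- For almost every value `a` of `z_t`, the conditional law of `z_{t+1}` is the product of the laws
with densities `p.dens k r a`, and its image under the change of representation is a product. -/
theorem ae_hasProductImage {Ω : Type*} [MeasurableSpace Ω] [StandardBorelSpace Ω]
    {P : Measure Ω} [IsProbabilityMeasure P] {M : Model m nf nc no d₁ d₂ X}
    {ε : Fin (m + 1) → ℕ → Idx nf nc no → Ω → ℝ}
    {z : Fin (m + 1) → ℕ → Ω → Latent nf nc no} {x : Fin (m + 1) → ℕ → Ω → X}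
    {p : Densities m nf nc no} {t : ℕ} (hp : p.AreDensitiesOf P z t)
    (h : Generates M P ε z x) (r : Fin (m + 1)) {ghat : X → Latent nf nc no}
    (hH : MeasurableEmbedding (ghat ∘ M.g)) (hmeas : Measurable fun ω => ghat (x r t ω))
    (hindep : ComponentsCondIndep P (fun ω => ghat (x r (t + 1) ω))
      (fun ω => ghat (x r t ω)) hmeas) :
    ∀ᵐ a ∂(P.map (z r t)), p.HasProductImage (ghat ∘ M.g) r a := by
  have := h.isProbabilityMeasure_noiseLaw
  have hz := h.measurable_latent r
  have hx : ∀ s, (fun ω => ghat (x r s ω)) = fun ω => (ghat ∘ M.g) (z r s ω) := fun s =>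
    funext fun ω => by rw [h.observed]; rfl
  have hind : iCondIndepFun (MeasurableSpace.comap (fun ω => (ghat ∘ M.g) (z r t ω)) inferInstance)
      (by rw [← hx]; exact hmeas.comap_le) (fun k ω => (ghat ∘ M.g) (z r (t + 1) ω) k) P := by
    have := hindep
    simp only [ComponentsCondIndep, hx] at this
    convert this using 3
    rw [h.observed]; rfl
  filter_upwards [ae_map_eq_pi_of_iCondIndepFun (hz t) (hz (t + 1)) _ (h.condDistrib_latent r t) hH
    _ hind, ae_all_iff.2 fun k => hp.ae_map_step h r k] with a h₁ h₂
  rw [M.transition_apply, funext h₂] at h₁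
  refine ⟨fun k => ?_, h₁⟩
  rw [← h₂ k]
  exact Measure.isProbabilityMeasure_map
    (M.measurable_step_comp r k measurable_const measurable_id).aemeasurable

/-! ### Mixed derivatives of separable functions -/

open Topology in
/-- A continuous function that is almost everywhere additively separable has vanishing mixed second
differences. -/
theorem eventually_secondDifference_eq {ι : Type*} [Fintype ι] [DecidableEq ι] {U : Set (ι → ℝ)}
    (hU : IsOpen U) {G : (ι → ℝ) → ℝ} (hG : ContinuousOn G U) (F : ι → ℝ → ℝ)
    (hae : ∀ᵐ y, y ∈ U → G y = ∑ i, F i (y i)) {j j' : ι} (hne : j ≠ j') {y : ι → ℝ} (hy : y ∈ U) :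
    ∀ᶠ t in 𝓝 (0 : ℝ), ∀ᶠ s in 𝓝 (0 : ℝ),
      G (y + s • Pi.single j 1 + t • Pi.single j' 1) =
        G (y + s • Pi.single j 1) + (G (y + t • Pi.single j' 1) - G y) := by
  obtain ⟨δ, hδ, hball⟩ := Metric.isOpen_iff.1 hU y hy
  have hδ3 : 0 < δ / 3 := by positivity
  filter_upwards [Metric.ball_mem_nhds (0 : ℝ) hδ3] with t ht
  filter_upwards [Metric.ball_mem_nhds (0 : ℝ) hδ3] with s hs
  rw [Metric.mem_ball, dist_zero_right] at ht hs
  have hn : ∀ (c : ℝ) (i : ι), ‖c • (Pi.single i 1 : ι → ℝ)‖ = ‖c‖ := fun c i => by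
    rw [norm_smul, Pi.norm_single]; simp
  set a : ι → ℝ := s • Pi.single j 1 with ha
  set b : ι → ℝ := t • Pi.single j' 1 with hb
  have hna : ‖a‖ < δ / 3 := by rw [ha, hn]; exact hs
  have hnb : ‖b‖ < δ / 3 := by rw [hb, hn]; exact ht
  have hnab : ‖a + b‖ < δ / 3 + δ / 3 := (norm_add_le _ _).trans_lt (add_lt_add hna hnb)
  have hmem : ∀ c : ι → ℝ, ‖c‖ < δ / 3 + δ / 3 → ∀ u ∈ Metric.ball y (δ / 3), u + c ∈ U := by
    intro c hc u hu
    refine hball ?_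
    rw [Metric.mem_ball, dist_eq_norm] at hu ⊢
    calc ‖u + c - y‖ = ‖(u - y) + c‖ := by congr 1; abel
      _ ≤ ‖u - y‖ + ‖c‖ := norm_add_le _ _
      _ < δ := by linarith
  have hmem0 : ∀ u ∈ Metric.ball y (δ / 3), u ∈ U := fun u hu => by
    simpa using hmem 0 (by simpa using by positivity) u hu
  have hma := hmem a (by linarith)
  have hmb := hmem b (by linarith)
  have hmab := hmem (a + b) hnab
  have htr : ∀ c : ι → ℝ, ∀ᵐ u, u + c ∈ U → G (u + c) = ∑ i, F i ((u + c) i) := fun c =>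
    (measurePreserving_add_right volume c).quasiMeasurePreserving.ae hae
  have hcont : ∀ c : ι → ℝ, (∀ u ∈ Metric.ball y (δ / 3), u + c ∈ U) →
      ContinuousOn (fun u => G (u + c)) (Metric.ball y (δ / 3)) := fun c hc =>
    hG.comp (by fun_prop) hc
  -- The point `y` may lie in the exceptional set, so the whole parallelogram is translated: the
  -- identity holds for almost every base point near `y`, hence at `y` by continuity.
  have key := Measure.eqOn_open_of_ae_eq (μ := (volume : Measure (ι → ℝ)))
    (U := Metric.ball y (δ / 3)) (f := fun u => G (u + (a + b)))
    (g := fun u => G (u + a) + (G (u + b) - G u)) ?_ Metric.isOpen_ball (hcont _ hmab)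
    ((hcont _ hma).add ((hcont _ hmb).sub (hG.mono hmem0)))
  · have := key (Metric.mem_ball_self hδ3)
    simpa only [add_assoc] using this
  · rw [Filter.EventuallyEq, ae_restrict_iff' Metric.isOpen_ball.measurableSet]
    filter_upwards [hae, htr a, htr b, htr (a + b)] with u h₀ h₁ h₂ h₃ hu
    rw [h₀ (hmem0 u hu), h₁ (hma u hu), h₂ (hmb u hu), h₃ (hmab u hu), ← Finset.sum_sub_distrib,
      ← Finset.sum_add_distrib]
    refine Finset.sum_congr rfl fun i _ => ?_
    by_cases hi : i = j
    · subst hi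
      simp [hb, Pi.single_eq_of_ne hne]
    · simp [ha, Pi.single_eq_of_ne hi]

open Topology in
/-- If `∑ f_k (ζ_k y)` is almost everywhere additively separable in `y`, then its mixed second
partial derivatives vanish. -/
theorem sum_mixed_deriv_eq_zero {ι : Type*} [Fintype ι] [DecidableEq ι] {U : Set (ι → ℝ)}
    (hU : IsOpen U) {ζ : (ι → ℝ) → ι → ℝ} (hζ : ∀ y ∈ U, ContDiffAt ℝ 2 ζ y) {f : ι → ℝ → ℝ}
    (hf : ∀ k, Differentiable ℝ (f k)) (hf' : ∀ k, Differentiable ℝ (deriv (f k)))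
    (F : ι → ℝ → ℝ) (hae : ∀ᵐ y, y ∈ U → ∑ k, f k (ζ y k) = ∑ i, F i (y i)) {j j' : ι}
    (hne : j ≠ j') {y : ι → ℝ} (hy : y ∈ U) :
    ∑ k, (deriv (deriv (f k)) (ζ y k) *
        (fderiv ℝ ζ y (Pi.single j 1) k * fderiv ℝ ζ y (Pi.single j' 1) k) +
      deriv (f k) (ζ y k) * fderiv ℝ (fderiv ℝ ζ) y (Pi.single j' 1) (Pi.single j 1) k) = 0 := by
  set e : ι → ℝ := Pi.single j 1 with he
  set e' : ι → ℝ := Pi.single j' 1 with he'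
  have hζd : ∀ u ∈ U, HasFDerivAt ζ (fderiv ℝ ζ u) u := fun u hu =>
    ((hζ u hu).differentiableAt (by norm_num)).hasFDerivAt
  have hζk : ∀ (u d : ι → ℝ), u ∈ U → ∀ k,
      HasDerivAt (fun c : ℝ => ζ (u + c • d) k) (fderiv ℝ ζ u d k) 0 := by
    intro u d hu k
    have h1 : HasDerivAt (fun c : ℝ => u + c • d) d 0 := by
      simpa using ((hasDerivAt_id (0 : ℝ)).smul_const d).const_add u
    have h2 : HasFDerivAt ζ (fderiv ℝ ζ u) (u + (0 : ℝ) • d) := by simpa using hζd u hu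
    exact hasDerivAt_pi.1 (h2.comp_hasDerivAt (0 : ℝ) h1) k
  have hGd : ∀ (u d : ι → ℝ), u ∈ U →
      HasDerivAt (fun c : ℝ => ∑ k, f k (ζ (u + c • d) k))
        (∑ k, deriv (f k) (ζ u k) * fderiv ℝ ζ u d k) 0 := by
    intro u d hu
    refine HasDerivAt.fun_sum fun k _ => ?_
    have h3 : HasDerivAt (f k) (deriv (f k) (ζ u k)) (ζ (u + (0 : ℝ) • d) k) := by
      simpa using (hf k (ζ u k)).hasDerivAt
    exact h3.comp (0 : ℝ) (hζk u d hu k)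
  have hGc : ContinuousOn (fun y => ∑ k, f k (ζ y k)) U := by
    refine continuousOn_finsetSum _ fun k _ => (hf k).continuous.comp_continuousOn ?_
    intro u hu
    exact ((continuous_apply k).continuousAt.comp (hζd u hu).continuousAt).continuousWithinAt
  have hUe : ∀ᶠ t in 𝓝 (0 : ℝ), y + t • e' ∈ U := by
    have hc : ContinuousAt (fun t : ℝ => y + t • e') 0 := by fun_prop
    exact hc.eventually_mem (by simpa using hU.mem_nhds hy)
  -- Differentiating the second-difference identity in `s` at `0`: the derivative along `e` does not
  -- change under small shifts along `e'`.
  have hconst : ∀ᶠ t in 𝓝 (0 : ℝ),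
      ∑ k, deriv (f k) (ζ (y + t • e') k) * fderiv ℝ ζ (y + t • e') e k =
        ∑ k, deriv (f k) (ζ y k) * fderiv ℝ ζ y e k := by
    filter_upwards [hUe, eventually_secondDifference_eq hU hGc F hae hne hy] with t htU ht
    have h1 := hGd (y + t • e') e htU
    have h2 := (hGd y e hy).add_const
      ((∑ k, f k (ζ (y + t • e') k)) - ∑ k, f k (ζ y k))
    refine h1.unique (h2.congr_of_eventuallyEq ?_)
    filter_upwards [ht] with s hs
    rw [show y + t • e' + s • e = y + s • e + t • e' by abel]
    exact hs
  have hD2 : HasFDerivAt (fderiv ℝ ζ) (fderiv ℝ (fderiv ℝ ζ) y) y :=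
    (((hζ y hy).fderiv_right (m := 1) (by norm_num)).differentiableAt (by norm_num)).hasFDerivAt
  have hlhs : HasDerivAt
      (fun t : ℝ => ∑ k, deriv (f k) (ζ (y + t • e') k) * fderiv ℝ ζ (y + t • e') e k)
      (∑ k, (deriv (deriv (f k)) (ζ y k) * fderiv ℝ ζ y e' k * fderiv ℝ ζ y e k +
        deriv (f k) (ζ y k) * fderiv ℝ (fderiv ℝ ζ) y e' e k)) 0 := by
    refine HasDerivAt.fun_sum fun k _ => ?_
    have h3 : HasDerivAt (deriv (f k)) (deriv (deriv (f k)) (ζ y k)) (ζ (y + (0 : ℝ) • e') k) := by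
      simpa using (hf' k (ζ y k)).hasDerivAt
    have h4 := h3.comp (0 : ℝ) (hζk y e' hy k)
    have h5 : HasDerivAt (fun c : ℝ => y + c • e') e' 0 := by
      simpa using ((hasDerivAt_id (0 : ℝ)).smul_const e').const_add y
    have h6 : HasFDerivAt (fderiv ℝ ζ) (fderiv ℝ (fderiv ℝ ζ) y) (y + (0 : ℝ) • e') := by
      simpa using hD2
    have h7 : HasDerivAt (fun c : ℝ => fderiv ℝ ζ (y + c • e')) (fderiv ℝ (fderiv ℝ ζ) y e') 0 :=
      h6.comp_hasDerivAt (0 : ℝ) h5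
    have h7' : HasDerivAt (fun c : ℝ => fderiv ℝ ζ (y + c • e') e)
        (fderiv ℝ (fderiv ℝ ζ) y e' e) 0 :=
      (ContinuousLinearMap.apply ℝ (ι → ℝ) e).hasFDerivAt.comp_hasDerivAt (0 : ℝ) h7
    have h8 := h4.fun_mul (hasDerivAt_pi.1 h7' k)
    simp only [Function.comp_apply, zero_smul, add_zero] at h8
    exact h8
  have h0 := hlhs.unique ((hasDerivAt_const (0 : ℝ) _).congr_of_eventuallyEq hconst)
  rw [← h0]
  exact Finset.sum_congr rfl fun k _ => by ring

/-! ### From almost all pasts to a linear relation -/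

/-- Translation invariance and Fubini, applied to a measurable hull of the exceptional set because
`q` need not be measurable. -/
theorem ae_ae_add_smul {ι : Type*} [Fintype ι] {q : (ι → ℝ) → Prop} (h : ∀ᵐ b, q b)
    (e : ι → ℝ) : ∀ᵐ b : ι → ℝ, ∀ᵐ c : ℝ, q (b + c • e) := by
  set N := toMeasurable volume {b : ι → ℝ | ¬ q b} with hN
  have hNm : MeasurableSet N := measurableSet_toMeasurable _ _
  have hN0 : ∀ᵐ b : ι → ℝ, b ∉ N := by
    rw [ae_iff] at h ⊢
    simpa [hN] using h
  have hm : MeasurableSet {x : ℝ × (ι → ℝ) | x.2 + x.1 • e ∉ N} := by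
    have : Measurable fun x : ℝ × (ι → ℝ) => x.2 + x.1 • e := by fun_prop
    exact this hNm.compl
  have h1 : ∀ᵐ c : ℝ, ∀ᵐ b : ι → ℝ, b + c • e ∉ N := ae_of_all _ fun c =>
    (measurePreserving_add_right volume (c • e)).quasiMeasurePreserving.ae hN0
  filter_upwards [(Measure.ae_ae_comm hm).1 h1] with b hb
  filter_upwards [hb] with c hc
  by_contra hq
  exact hc (subset_toMeasurable _ _ hq)

/-- A separately continuous function that vanishes almost everywhere vanishes everywhere. -/
theorem eq_zero_of_ae_of_separately_continuous {ι : Type*} [Fintype ι] [DecidableEq ι]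
    {f : (ι → ℝ) → ℝ} (hc : ∀ a l, Continuous fun c : ℝ => f (Function.update a l c))
    (h : ∀ᵐ a, f a = 0) (a : ι → ℝ) : f a = 0 := by
  -- The coordinates of a generic `b` are replaced by those of `a` one at a time, each time using
  -- continuity in a single coordinate only.
  have main : ∀ s : Finset ι, ∀ᵐ b : ι → ℝ, f (s.piecewise a b) = 0 := by
    intro s
    induction s using Finset.induction_on with
    | empty => simpa using h
    | insert l s hl ih =>
      filter_upwards [ae_ae_add_smul ih (Pi.single l 1)] with b hb
      have e : ∀ c : ℝ, s.piecewise a (b + c • Pi.single l 1) =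
          Function.update (s.piecewise a b) l (b l + c) := by
        intro c
        funext i
        by_cases hi : i = l
        · subst hi; simp [hl]
        · by_cases his : i ∈ s <;> simp [hi, his]
      simp only [e] at hb
      have hcont : Continuous fun c : ℝ => f (Function.update (s.piecewise a b) l (b l + c)) :=
        (hc _ l).comp (continuous_const.add continuous_id)
      have h0 := Continuous.ae_eq_iff_eq (μ := (volume : Measure ℝ)) hcont continuous_const |>.1 hb
      have h1 := congrFun h0 (a l - b l)
      simp only [add_sub_cancel] at h1
      rw [Finset.piecewise_insert]
      exact h1
  simpa using main Finset.univ

/-- If `∑ (∂²η_k A_k + ∂η_k B_k)` takes the same value in all segments and for almost all values of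
`z_{t-1}`, then the coefficients `A_k` vanish. -/
theorem Densities.coeff_eq_zero {p : Densities m nf nc no} (hreg : p.Regular)
    (hli : p.FunctionVectorsIndependent) (w A B : Latent nf nc no) (C : ℝ)
    (h : ∀ r, ∀ᵐ a : Latent nf nc no,
      ∑ k, (p.eta2 k r a (w k) * A k + p.eta1 k r a (w k) * B k) = C) (k : Idx nf nc no) :
    A k = 0 := by
  have hall : ∀ r a, ∑ k, (p.eta2 k r a (w k) * A k + p.eta1 k r a (w k) * B k) = C := by
    intro r a
    rw [← sub_eq_zero]
    refine eq_zero_of_ae_of_separately_continuous (f := fun a : Latent nf nc no =>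
      ∑ k, (p.eta2 k r a (w k) * A k + p.eta1 k r a (w k) * B k) - C) (fun a l => ?_) ?_ a
    · refine (continuous_finsetSum _ fun k _ => ?_).sub continuous_const
      exact ((hreg.diff_eta2_past k r a (w k) l).continuous.mul continuous_const).add
        ((hreg.diff_eta1_past k r a (w k) l).continuous.mul continuous_const)
    · filter_upwards [h r] with a ha
      rw [ha, sub_self]
  have hderiv : ∀ r l a, ∑ k, (p.vRing k r l a (w k) * A k + p.v k r l a (w k) * B k) = 0 := by
    intro r l a
    have h1 : HasDerivAt (fun c : ℝ => ∑ k, (p.eta2 k r (Function.update a l c) (w k) * A k +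
        p.eta1 k r (Function.update a l c) (w k) * B k))
        (∑ k, (p.vRing k r l a (w k) * A k + p.v k r l a (w k) * B k)) (a l) :=
      HasDerivAt.fun_sum fun k _ =>
        ((hreg.diff_eta2_past k r a (w k) l (a l)).hasDerivAt.mul_const (A k)).fun_add
          ((hreg.diff_eta1_past k r a (w k) l (a l)).hasDerivAt.mul_const (B k))
    simp only [hall] at h1
    exact h1.unique (hasDerivAt_const _ _)
  have hzero : ∑ i, (Sum.elim B A) i •
      (Sum.elim (fun k : Idx nf nc no => p.s k (w k)) (fun k => p.sRing k (w k))) i = 0 := by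
    rw [Fintype.sum_sum_type]
    simp only [Sum.elim_inl, Sum.elim_inr]
    rw [← Finset.sum_add_distrib]
    funext a
    rw [Finset.sum_apply]
    refine Prod.ext ?_ ?_
    · rw [Prod.fst_sum]
      funext r l
      rw [Finset.sum_apply, Finset.sum_apply]
      rw [show (0 : Latent nf nc no → (Fin (m + 1) → Idx nf nc no → ℝ) × (Fin m → ℝ)) a = 0 from rfl]
      simp only [Prod.fst_zero, Pi.zero_apply]
      rw [← hderiv r l a]
      refine Finset.sum_congr rfl fun k _ => ?_
      simp only [Densities.s, Densities.sRing, Pi.add_apply, Pi.smul_apply, Prod.fst_add,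
        Prod.smul_fst, smul_eq_mul]
      ring
    · rw [Prod.snd_sum]
      funext i
      rw [Finset.sum_apply]
      rw [show (0 : Latent nf nc no → (Fin (m + 1) → Idx nf nc no → ℝ) × (Fin m → ℝ)) a = 0 from rfl]
      simp only [Prod.snd_zero, Pi.zero_apply]
      -- The constant `C` is common to all segments, so it cancels between neighbouring ones.
      rw [← sub_self C]
      nth_rewrite 1 [← hall i.succ a]
      rw [← hall i.castSucc a, ← Finset.sum_sub_distrib]
      refine Finset.sum_congr rfl fun k _ => ?_
      simp only [Densities.s, Densities.sRing, Pi.add_apply, Pi.smul_apply, Prod.snd_add,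
        Prod.smul_snd, smul_eq_mul]
      ring
  exact Fintype.linearIndependent_iff.1 (hli w) _ hzero (Sum.inr k)

/-- If almost all the conditional laws of `z_{t+1}` have images under `H` that are product measures,
then every component of the inverse `ζ` of `H` depends on at most one coordinate to first order. -/
theorem Densities.fderiv_mul_fderiv_eq_zero {p : Densities m nf nc no} (hreg : p.Regular)
    (hli : p.FunctionVectorsIndependent) {H ζ : Latent nf nc no → Latent nf nc no}
    (hH : MeasurableEmbedding H) (hHd : Differentiable ℝ H) (hopen : IsOpen (Set.range H))
    (hleft : ∀ z, ζ (H z) = z) (hζ : ∀ y ∈ Set.range H, ContDiffAt ℝ 2 ζ y)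
    (hprod : ∀ r, ∀ᵐ a : Latent nf nc no, p.HasProductImage H r a)
    {y : Latent nf nc no} (hy : y ∈ Set.range H) {j j' : Idx nf nc no} (hne : j ≠ j')
    (k : Idx nf nc no) :
    fderiv ℝ ζ y (Pi.single j 1) k * fderiv ℝ ζ y (Pi.single j' 1) k = 0 := by
  have hmeas : ∀ r a k, Measurable (p.dens k r a) := by
    intro r a k
    have : p.dens k r a = fun y => Real.exp (p.eta k r a y) :=
      funext fun y => (Real.exp_log (hreg.pos k r a y)).symm
    rw [this]
    exact (Real.continuous_exp.comp (hreg.diff_eta k r a).continuous).measurable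
  have hmain : ∀ r r' a a',
      p.HasProductImage H r a → p.HasProductImage H r' a' →
      ∑ k, (p.eta2 k r a (ζ y k) *
          (fderiv ℝ ζ y (Pi.single j 1) k * fderiv ℝ ζ y (Pi.single j' 1) k) +
        p.eta1 k r a (ζ y k) *
          fderiv ℝ (fderiv ℝ ζ) y (Pi.single j' 1) (Pi.single j 1) k) =
      ∑ k, (p.eta2 k r' a' (ζ y k) *
          (fderiv ℝ ζ y (Pi.single j 1) k * fderiv ℝ ζ y (Pi.single j' 1) k) +
        p.eta1 k r' a' (ζ y k) *
          fderiv ℝ (fderiv ℝ ζ) y (Pi.single j' 1) (Pi.single j 1) k) := by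
    rintro r r' a a' ⟨h₁, h₂⟩ ⟨h₁', h₂'⟩
    obtain ⟨F, hF⟩ := log_density_separable _ _ (fun k => p.dens k r a) (fun k => p.dens k r' a')
      (hmeas r a) (hmeas r' a') (fun k => hreg.pos k r a) (fun k => hreg.pos k r' a')
      (fun _ => rfl) (fun _ => rfl) H hH h₂ h₂'
    have hd1 : ∀ k, deriv (fun u => p.eta k r a u - p.eta k r' a' u) =
        fun u => p.eta1 k r a u - p.eta1 k r' a' u := fun k => funext fun u =>
      deriv_fun_sub (hreg.diff_eta k r a u) (hreg.diff_eta k r' a' u)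
    have hd2 : ∀ k, deriv (fun u => p.eta1 k r a u - p.eta1 k r' a' u) =
        fun u => p.eta2 k r a u - p.eta2 k r' a' u := fun k => funext fun u =>
      deriv_fun_sub (hreg.diff_eta1 k r a u) (hreg.diff_eta1 k r' a' u)
    -- A differentiable map between spaces of equal dimension sends null sets to null sets, so the
    -- exceptional set may be moved through `H`.
    have hae : ∀ᵐ y, y ∈ Set.range H →
        ∑ k, (fun u => p.eta k r a u - p.eta k r' a' u) (ζ y k) = ∑ i, F i (y i) := by
      rw [ae_iff] at hF ⊢
      refine measure_mono_null ?_ (addHaar_image_eq_zero_of_differentiableOn_of_addHaar_eq_zero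
        volume hHd.differentiableOn hF)
      intro u hu
      simp only [Set.mem_ofPred_eq, Classical.not_imp] at hu
      obtain ⟨⟨v, rfl⟩, hu⟩ := hu
      refine ⟨v, ?_, rfl⟩
      rw [hleft] at hu
      exact hu
    have key := sum_mixed_deriv_eq_zero hopen hζ
      (f := fun k u => p.eta k r a u - p.eta k r' a' u)
      (fun k => (hreg.diff_eta k r a).fun_sub (hreg.diff_eta k r' a'))
      (fun k => by rw [hd1]; exact (hreg.diff_eta1 k r a).fun_sub (hreg.diff_eta1 k r' a'))
      F hae hne hy
    simp only [hd1, hd2] at key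
    rw [← sub_eq_zero, ← Finset.sum_sub_distrib, ← key]
    exact Finset.sum_congr rfl fun k _ => by ring
  -- A reference past in segment `0`; its sum serves as the common constant `C`.
  obtain ⟨a₀, ha₀⟩ := (hprod 0).exists
  have hconst := fun r => (hprod r).mono fun a ha => hmain r 0 a a₀ ha ha₀
  exact Densities.coeff_eq_zero hreg hli (ζ y)
    (fun k => fderiv ℝ ζ y (Pi.single j 1) k * fderiv ℝ ζ y (Pi.single j' 1) k)
    (fun k => fderiv ℝ (fderiv ℝ ζ) y (Pi.single j' 1) (Pi.single j 1) k) _ hconst k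

/-! ### Generalized permutation Jacobians -/

theorem apply_eq_sum_single {ι : Type*} [Fintype ι] [DecidableEq ι]
    (T : (ι → ℝ) →L[ℝ] (ι → ℝ)) (v : ι → ℝ) (k : ι) :
    T v k = ∑ j, v j * T (Pi.single j 1) k := by
  conv_lhs => rw [pi_eq_sum_univ' v]
  rw [map_sum, Finset.sum_apply]
  refine Finset.sum_congr rfl fun j _ => ?_
  rw [map_smul]
  rfl

/-- If every row of a left inverse of `D` has at most one nonzero entry, then `D` is a generalized
permutation matrix. -/
theorem exists_perm_of_leftInverse {ι : Type*} [Fintype ι] [DecidableEq ι]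
    (D T : (ι → ℝ) →L[ℝ] (ι → ℝ)) (hTD : ∀ v, T (D v) = v)
    (hT : ∀ j j', j ≠ j' → ∀ k, T (Pi.single j 1) k * T (Pi.single j' 1) k = 0) :
    ∃ σ : ι → ι, Function.Bijective σ ∧ ∀ k i, D (Pi.single k 1) i ≠ 0 ↔ i = σ k := by
  have hex : ∀ k, ∃ j, T (Pi.single j 1) k ≠ 0 := by
    intro k
    by_contra! hcon
    have h1 : T (D (Pi.single k 1)) k = 1 := by rw [hTD]; simp
    rw [apply_eq_sum_single] at h1
    simp [hcon] at h1
  choose σ hσ using hex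
  have hrow : ∀ v k, T v k = v (σ k) * T (Pi.single (σ k) 1) k := by
    intro v k
    rw [apply_eq_sum_single]
    refine Finset.sum_eq_single _ (fun j _ hj => ?_) (by simp)
    rw [(mul_eq_zero.1 (hT j (σ k) hj k)).resolve_right (hσ k), mul_zero]
  -- Row `k` of `T D = 1` reads `δ_kl = D_{σ k, l} T_{k, σ k}`, and the last factor is nonzero.
  have hentry : ∀ k l, D (Pi.single l 1) (σ k) ≠ 0 ↔ k = l := by
    intro k l
    have h1 := hrow (D (Pi.single l 1)) k
    rw [hTD] at h1
    by_cases hkl : k = l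
    · subst hkl
      simp only [Pi.single_eq_same] at h1
      refine iff_of_true (fun h0 => ?_) rfl
      rw [h0, zero_mul] at h1
      exact one_ne_zero h1
    · rw [Pi.single_eq_of_ne hkl] at h1
      refine iff_of_false (fun h0 => ?_) hkl
      exact (mul_ne_zero h0 (hσ k)) h1.symm
  have hinj : Function.Injective σ := fun k l hkl => by
    rw [← hentry k l, hkl]
    exact (hentry l l).2 rfl
  have hbij : Function.Bijective σ := Finite.injective_iff_bijective.1 hinj
  refine ⟨σ, hbij, fun k i => ?_⟩
  obtain ⟨l, rfl⟩ := hbij.2 i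
  rw [hentry, hinj.eq_iff]

/-- An injective map whose Jacobian is everywhere a generalized permutation matrix acts
component-wise, up to a permutation. -/
theorem identifiedUpToPermutation_of_fderiv {H : Latent nf nc no → Latent nf nc no}
    (hH : ContDiff ℝ 1 H) (hinj : Function.Injective H)
    (hperm : ∀ z, ∃ σ : Idx nf nc no → Idx nf nc no, Function.Bijective σ ∧
      ∀ k i, fderiv ℝ H z (Pi.single k 1) i ≠ 0 ↔ i = σ k) :
    IdentifiedUpToPermutation H := by
  choose σ hσ hσe using hperm
  -- Nonvanishing of a continuous entry is an open condition, so the pattern is locally constant on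
  -- a connected space.
  have hconst : ∀ z k, σ z k = σ 0 k := by
    intro z k
    have hloc : IsLocallyConstant fun z => σ z k := by
      rw [IsLocallyConstant.iff_isOpen_fiber]
      intro i
      have e : (fun z => σ z k) ⁻¹' {i} = {z | fderiv ℝ H z (Pi.single k 1) i ≠ 0} := by
        ext z
        simp only [Set.mem_preimage, Set.mem_singleton_iff, Set.mem_ofPred_eq, hσe, eq_comm]
      rw [e]
      have hc : Continuous fun z => fderiv ℝ H z (Pi.single k 1) i :=
        (continuous_apply i).comp ((hH.continuous_fderiv (by norm_num)).clm_apply continuous_const)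
      exact isOpen_ne_fun hc continuous_const
    exact hloc.apply_eq_of_preconnectedSpace z 0
  set π : Equiv.Perm (Idx nf nc no) := Equiv.ofBijective (σ 0) (hσ 0) with hπ
  have hzero : ∀ z k l, l ≠ k → fderiv ℝ H z (Pi.single l 1) (π k) = 0 := by
    intro z k l hl
    by_contra h0
    have h1 := (hσe z l _).1 h0
    rw [hconst] at h1
    exact hl (π.injective h1).symm
  have hdiff : Differentiable ℝ H := hH.differentiable (by norm_num)
  have hdep : ∀ k z w, z k = w k → H z (π k) = H w (π k) := by
    intro k z w hzw
    have hd : ∀ s : ℝ, HasDerivAt (fun s : ℝ => H (z + s • (w - z)) (π k)) 0 s := by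
      intro s
      have h1 : HasDerivAt (fun s : ℝ => z + s • (w - z)) (w - z) s := by
        simpa using ((hasDerivAt_id s).smul_const (w - z)).const_add z
      have h2 := hasDerivAt_pi.1 ((hdiff _).hasFDerivAt.comp_hasDerivAt s h1) (π k)
      rw [apply_eq_sum_single, Finset.sum_eq_zero] at h2
      · exact h2
      · intro l _
        by_cases hl : l = k
        · subst hl; simp [hzw]
        · rw [hzero _ _ _ hl, mul_zero]
    have := is_const_of_deriv_eq_zero (fun s => (hd s).differentiableAt) (fun s => (hd s).deriv) 0 1
    simpa using this
  -- By `hdep` the other coordinates are irrelevant and may be set to `0`.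
  set φ : Idx nf nc no → ℝ → ℝ := fun k c => H (Pi.single k c) (π k) with hφ
  have hHφ : ∀ z k, H z (π k) = φ k (z k) := fun z k => hdep k _ _ (by simp)
  have hφinj : ∀ k, Function.Injective (φ k) := by
    intro k c d hcd
    have h1 : H (Pi.single k c) = H (Pi.single k d) := by
      funext i
      obtain ⟨l, rfl⟩ := π.surjective i
      by_cases hl : l = k
      · subst hl; exact hcd
      · exact hdep l _ _ (by simp [Pi.single_eq_of_ne hl])
    exact Pi.single_injective k (hinj h1)
  have hτ : ∀ z k, z k = Function.invFun (φ k) (H z (π k)) := fun z k => by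
    rw [hHφ, Function.leftInverse_invFun (hφinj k)]
  refine ⟨π, fun k => Function.invFun (φ k), fun k => ⟨fun _ _ => trivial, ?_, ?_⟩, hτ⟩
  · rintro _ ⟨z, rfl⟩ _ ⟨w, rfl⟩ h
    simp only [← hτ] at h
    exact hdep k z w h
  · intro c _
    exact ⟨H (Pi.single k c) (π k), ⟨_, rfl⟩, by simp only [← hτ, Pi.single_eq_same]⟩

/-- Nonsingular derivatives make `H` open and injectivity makes it an open embedding, so the local
inverses are restrictions of one map. Surjectivity is not needed; off the range `ζ` is uncontrolled.
-/
theorem exists_contDiffAt_leftInverse {E : Type*} [NormedAddCommGroup E] [NormedSpace ℝ E]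
    [FiniteDimensional ℝ E] {H : E → E} (hH : ContDiff ℝ 2 H) (hinj : Function.Injective H)
    (hdet : ∀ z, (fderiv ℝ H z).det ≠ 0) :
    IsOpen (Set.range H) ∧
      ∃ ζ : E → E, (∀ z, ζ (H z) = z) ∧ ∀ y ∈ Set.range H, ContDiffAt ℝ 2 ζ y := by
  have : CompleteSpace E := FiniteDimensional.complete ℝ E
  have hd : ∀ z, HasStrictFDerivAt H
      ((fderiv ℝ H z).toContinuousLinearEquivOfDetNeZero (hdet z) : E →L[ℝ] E) z := fun z => by
    rw [ContinuousLinearMap.coe_toContinuousLinearEquivOfDetNeZero]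
    exact hH.contDiffAt.hasStrictFDerivAt (by norm_num)
  have hemb : Topology.IsOpenEmbedding H := .of_continuous_injective_isOpenMap hH.continuous hinj
    (isOpenMap_of_hasStrictFDerivAt_equiv hd)
  refine ⟨hemb.isOpen_range, (hemb.toOpenPartialHomeomorph H).symm,
    fun z => hemb.toOpenPartialHomeomorph_left_inv, fun y hy => ?_⟩
  refine OpenPartialHomeomorph.contDiffAt_symm _ (by simpa using hy) (hd _).hasFDerivAt
    hH.contDiffAt

end ModularShift

theorem corollary3 {m nf nc no d₁ d₂ : ℕ} {X Ω : Type*} [MeasurableSpace Ω]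
    [StandardBorelSpace Ω] (P : Measure Ω) [IsProbabilityMeasure P]
    (M : ModularShift.Model m nf nc no d₁ d₂ X)
    (ε : Fin (m + 1) → ℕ → ModularShift.Idx nf nc no → Ω → ℝ)
    (z : Fin (m + 1) → ℕ → Ω → ModularShift.Latent nf nc no)
    (x : Fin (m + 1) → ℕ → Ω → X)
    (hgen : ModularShift.Generates M P ε z x)
    (t : ℕ)
    (hfull : ∀ r, volume ≪ P.map (z r t))
    (p : ModularShift.Densities m nf nc no)
    (hp : p.AreDensitiesOf P z t)
    (hreg : p.Regular)
    (hli : p.FunctionVectorsIndependent)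
    (ghat : X → ModularShift.Latent nf nc no)
    (hghat : Function.Injective ghat)
    (hsmooth : ContDiff ℝ 2 (ghat ∘ M.g))
    (hjac : ∀ w, (fderiv ℝ (ghat ∘ M.g) w).det ≠ 0)
    (hmeas : ∀ r, Measurable fun ω => ghat (x r t ω))
    (hindep : ∀ r, ModularShift.ComponentsCondIndep P (fun ω => ghat (x r (t + 1) ω))
      (fun ω => ghat (x r t ω)) (hmeas r)) :
    ModularShift.IdentifiedUpToPermutation (ghat ∘ M.g) := by
  have hinj : Function.Injective (ghat ∘ M.g) := hghat.comp M.bijective_g.injective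
  have hdiff : Differentiable ℝ (ghat ∘ M.g) := hsmooth.differentiable (by norm_num)
  have hemb : MeasurableEmbedding (ghat ∘ M.g) := hsmooth.continuous.measurableEmbedding hinj
  obtain ⟨hopen, ζ, hleft, hζ⟩ := ModularShift.exists_contDiffAt_leftInverse hsmooth hinj hjac
  -- Full support of the past turns "almost surely" into "Lebesgue almost everywhere".
  have hprod : ∀ r, ∀ᵐ a, p.HasProductImage (ghat ∘ M.g) r a := fun r => (hfull r).ae_le
    (ModularShift.ae_hasProductImage hp hgen r hemb (hmeas r) (hindep r))
  refine ModularShift.identifiedUpToPermutation_of_fderiv (hsmooth.of_le (by norm_num)) hinj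
    fun w => ModularShift.exists_perm_of_leftInverse _ (fderiv ℝ ζ ((ghat ∘ M.g) w)) (fun v => ?_)
      fun j j' hne k => ModularShift.Densities.fderiv_mul_fderiv_eq_zero hreg hli hemb hdiff hopen
        hleft hζ hprod ⟨w, rfl⟩ hne k
  have hcomp := ((hζ _ ⟨w, rfl⟩).differentiableAt (by norm_num)).hasFDerivAt.comp w
    (hdiff w).hasFDerivAt
  have hid : ζ ∘ (ghat ∘ M.g) = id := funext hleft
  rw [hid] at hcomp
  exact DFunLike.congr_fun (hcomp.unique (hasFDerivAt_id w)) v
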